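/- Let $c(x,y)=(x_1-y_1)(x_2-y_2)$ for $x,y\in\mathbb{R}^2$. Let $Y=(Y_1,Y_2)$ be a two-dimensional random variable with finite second moment on a probability space $(\Omega,\mathcal{F},\mathbb{P})$, and suppose that its law $\nu$ is atomless. Let $\Gamma(\nu)$ be the set of Borel probability measures $\gamma=\gamma(dx,dy)$ on $\mathbb{R}^2\times\mathbb{R}^2$ with finite second moment whose $y$-marginal is $\nu$ and for which the canonical process is a martingale, that is, $\gamma(y\,|\,x)=x$ (the conditional expectation under $\gamma$ of the second component $y$ given the first component $x$ equals $x$). Let $\mathcal{X}(Y)$ be the set of square-integrable two-dimensional random variables $X$ on $(\Omega,\mathcal{F},\mathbb{P})$ that are $Y$-measurable and satisfy $\mathbb{E}[Y\,|\,X]=X$; random variables that coincide almost surely are identified. Then the minimum on the left-hand side below is attained, and $$\min_{\gamma\in\Gamma(\nu)}\int c(x,y)\,d\gamma=\inf_{X\in\mathcal{X}(Y)}\mathbb{E}[c(X,Y)].$$ -/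

import Mathlib

open MeasureTheory

noncomputable section

namespace BackwardMartingale

/-- The plane `ℝ²` with its Euclidean norm. -/
abbrev Plane : Type := EuclideanSpace ℝ (Fin 2)

/-- The covariance-type cost `c(x, y) = (x₁ - y₁) (x₂ - y₂)`. -/
def cost (x y : Plane) : ℝ := (x 0 - y 0) * (x 1 - y 1)

/-- `Γ(ν)`: the Borel probability measures `γ(dx, dy)` on `ℝ² × ℝ²` with finite second moment,
whose `y`-marginal is `ν`, and which make the canonical process `(x, y)` a martingale:
`γ(y | x) = x`, coordinate by coordinate. -/
def plans (ν : Measure Plane) : Set (Measure (Plane × Plane)) :=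
  {γ | IsProbabilityMeasure γ ∧ MemLp (fun z : Plane × Plane => z) 2 γ ∧
    γ.map Prod.snd = ν ∧
    ∀ i : Fin 2,
      γ[fun z : Plane × Plane => z.2 i |
          MeasurableSpace.comap (Prod.fst : Plane × Plane → Plane) inferInstance]
        =ᵐ[γ] fun z => z.1 i}

/-- `𝒳(Y)`: the square-integrable random variables `X` in `ℝ²` that are `Y`-measurable and satisfy
`E[Y | X] = X`, coordinate by coordinate. Random variables are identified when they agree almost
surely, so `Y`-measurability means that `X = f(Y)` almost surely for some Borel function `f`. -/
def maps {Ω : Type*} [MeasurableSpace Ω] (P : Measure Ω) (Y : Ω → Plane) : Set (Ω → Plane) :=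
  {X | Measurable X ∧ MemLp X 2 P ∧
    (∃ f : Plane → Plane, Measurable f ∧ X =ᵐ[P] fun ω => f (Y ω)) ∧
    ∀ i : Fin 2,
      P[fun ω => Y ω i | MeasurableSpace.comap X inferInstance] =ᵐ[P] fun ω => X ω i}

/-- The average cost of a plan. -/
def planCost (γ : Measure (Plane × Plane)) : ℝ := ∫ z, cost z.1 z.2 ∂γ

/-- The average cost `E[c(X, Y)]` of a map. -/
def mapCost {Ω : Type*} [MeasurableSpace Ω] (P : Measure Ω) (Y X : Ω → Plane) : ℝ :=
  ∫ ω, cost (X ω) (Y ω) ∂P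

end BackwardMartingale

end

/-! The joint law of (X, Y) is a plan with the same cost as X, so the minimum is at most the
infimum. Two facts remain.

Attainment. Conditional expectation contracts L², so the second moments of all plans are bounded by
2∫|y|²dν; plans are tight and a minimising sequence has a weakly convergent subsequence. Its limit
is a plan (`mem_plans_of_tendsto`). The cost is unbounded below with quadratic growth, so weak
convergence alone does not control it. But every plan satisfies ∫(|x|² - x·y)dγ = 0 and has the same
∫|y|²dγ; adding these quantities turns c into the nonnegative continuous `shiftedCost`, whose
integral is lower semicontinuous.

Approximation (`exists_map_planCost_le`). Given a plan γ, replace y by a simple function t(y) that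
is δ-close in L². Since ν is atomless, each cell of t can be transported onto the matching slice of
γ, giving S(y) such that (S, t) under ν has the law of (x, t(y)) under γ. Then f = E[y | S] is a
martingale map by the tower property. Moreover f is δ-close to E[t | S], which is δ-close to S
because E[y | x] = x under γ. The cost is continuous in L², and δ tends to 0. -/

noncomputable section

namespace BackwardMartingale

open ProbabilityTheory Set Filter Topology unitInterval

/-! ### Transport of atomless measures -/

/-- The cumulative distribution function of an atomless law is continuous. -/
lemma continuous_cdf (m : Measure ℝ) [IsProbabilityMeasure m] [NullSingletonClass m] :
    Continuous (cdf m) := by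
  rw [continuous_iff_continuousAt]
  intro x
  rw [(monotone_cdf m).continuousAt_iff_leftLim_eq_rightLim, StieltjesFunction.rightLim_eq]
  have h := (cdf m).measure_singleton x
  rw [measure_cdf, measure_singleton] at h
  have h1 := (monotone_cdf m).leftLim_le (le_refl x)
  have h2 := ENNReal.ofReal_eq_zero.1 h.symm
  linarith

/-- The cumulative distribution function of an atomless law, with values in the unit interval. -/
def cdfUnit (m : Measure ℝ) (x : ℝ) : I := ⟨cdf m x, cdf_nonneg m x, cdf_le_one m x⟩

lemma measurable_cdfUnit (m : Measure ℝ) : Measurable (cdfUnit m) :=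
  (monotone_cdf m).measurable.subtype_mk

/-- The probability integral transform. -/
lemma map_cdfUnit (m : Measure ℝ) [IsProbabilityMeasure m] [NullSingletonClass m] :
    m.map (cdfUnit m) = volume := by
  have := Measure.isProbabilityMeasure_map (μ := m) (measurable_cdfUnit m).aemeasurable
  refine Measure.ext_of_Iic _ _ fun u => ?_
  rw [Measure.map_apply (measurable_cdfUnit m) measurableSet_Iic, unitInterval.volume_Iic]
  have hpre : cdfUnit m ⁻¹' Iic u = {x | cdf m x ≤ u} := rfl
  rw [hpre]
  -- The level u = 1 is separate: the sublevel set is then the whole line and has no supremum.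
  rcases eq_or_lt_of_le u.2.2 with hu1 | hu1
  · have : {x | cdf m x ≤ u} = univ := by
      ext x; simp [hu1, cdf_le_one m x]
    rw [this, hu1]; simp
  by_cases hne : {x | cdf m x ≤ u}.Nonempty
  · obtain ⟨b, hb⟩ := ((tendsto_cdf_atTop m).eventually (lt_mem_nhds hu1)).exists
    have hbdd : BddAbove {x | cdf m x ≤ u} :=
      ⟨b, fun x hx => le_of_not_gt fun h => absurd (monotone_cdf m h.le) (by
        have : cdf m x ≤ u := hx
        linarith)⟩
    have hcl : IsClosed {x | cdf m x ≤ u} := isClosed_le (continuous_cdf m) continuous_const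
    set s := sSup {x | cdf m x ≤ u} with hs
    have hmem : cdf m s ≤ u := hcl.csSup_mem hne hbdd
    have hset : {x | cdf m x ≤ u} = Iic s := by
      ext x
      exact ⟨fun hx => le_csSup hbdd hx, fun hx => (monotone_cdf m hx).trans hmem⟩
    have hge : (u : ℝ) ≤ cdf m s := by
      refine ge_of_tendsto ((continuous_cdf m).continuousWithinAt (s := Ioi s) (x := s)) ?_
      filter_upwards [self_mem_nhdsWithin] with x hx
      by_contra! h
      exact absurd (le_csSup hbdd (show x ∈ {x | cdf m x ≤ u} from h.le)) (not_le.2 hx)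
    rw [hset, ← ofReal_cdf, le_antisymm hmem hge]
  · rw [not_nonempty_iff_eq_empty.1 hne, measure_empty]
    have : (u : ℝ) ≤ 0 := by
      refine ge_of_tendsto (tendsto_cdf_atBot m) (Eventually.of_forall fun x => ?_)
      by_contra! h
      exact hne ⟨x, h.le⟩
    rw [ENNReal.ofReal_eq_zero.2 this]

/-- An atomless probability measure can be transported to any other one by a measurable map. -/
lemma exists_map_eq_of_isProbabilityMeasure {E F : Type*} [MeasurableSpace E] [StandardBorelSpace E]
    [MeasurableSpace F] [StandardBorelSpace F] [Nonempty F] (ν : Measure E) (μ : Measure F)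
    [IsProbabilityMeasure ν] [NullSingletonClass ν] [IsProbabilityMeasure μ] :
    ∃ S : E → F, Measurable S ∧ ν.map S = μ := by
  have hφ := measurableEmbedding_embeddingReal E
  have : IsProbabilityMeasure (ν.map (embeddingReal E)) :=
    Measure.isProbabilityMeasure_map hφ.measurable.aemeasurable
  have : NullSingletonClass (ν.map (embeddingReal E)) := ⟨fun x => by
    rw [hφ.map_apply]
    exact (subsingleton_singleton.preimage hφ.injective).measure_zero ν⟩
  obtain ⟨f, hf, hfμ⟩ := μ.exists_measurable_map_eq
  -- Embed E in the line, where the law stays atomless, pass to the uniform law by the distribution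
  -- function, then push the uniform law to μ.
  refine ⟨f ∘ cdfUnit (ν.map (embeddingReal E)) ∘ embeddingReal E,
    hf.comp ((measurable_cdfUnit _).comp hφ.measurable), ?_⟩
  rw [← Measure.map_map hf ((measurable_cdfUnit _).comp hφ.measurable),
    ← Measure.map_map (measurable_cdfUnit _) hφ.measurable, map_cdfUnit, hfμ]

/-- An atomless finite measure can be transported to any other one of the same mass. -/
lemma exists_map_eq_of_measure_univ_eq {E F : Type*} [MeasurableSpace E] [StandardBorelSpace E]
    [MeasurableSpace F] [StandardBorelSpace F] [Nonempty F] (ν : Measure E) (μ : Measure F)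
    [IsFiniteMeasure ν] [NullSingletonClass ν] (h : ν univ = μ univ) :
    ∃ S : E → F, Measurable S ∧ ν.map S = μ := by
  by_cases h0 : ν univ = 0
  · refine ⟨fun _ => Classical.arbitrary F, measurable_const, ?_⟩
    have h0' : μ univ = 0 := h ▸ h0
    rw [Measure.measure_univ_eq_zero.1 h0, Measure.measure_univ_eq_zero.1 h0', Measure.map_zero]
  have hfin : ν univ ≠ ⊤ := measure_ne_top ν univ
  have : IsProbabilityMeasure ((ν univ)⁻¹ • ν) := ⟨by
    simp [ENNReal.inv_mul_cancel h0 hfin]⟩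
  have : IsProbabilityMeasure ((ν univ)⁻¹ • μ) := ⟨by
    simp [← h, ENNReal.inv_mul_cancel h0 hfin]⟩
  have : NullSingletonClass ((ν univ)⁻¹ • ν) := ⟨fun x => by simp⟩
  obtain ⟨S, hS, hSμ⟩ := exists_map_eq_of_isProbabilityMeasure ((ν univ)⁻¹ • ν) ((ν univ)⁻¹ • μ)
  refine ⟨S, hS, ?_⟩
  rw [Measure.map_smul] at hSμ
  have := congrArg (fun m => ν univ • m) hSμ
  simpa [smul_smul, ENNReal.mul_inv_cancel h0 hfin] using this

/-- A coupling with an atomless second marginal is realised by a measurable map, as long as only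
finitely many events of the second coordinate are observed. -/
lemma exists_map_prodMk_simpleFunc_eq {E F G : Type*} [MeasurableSpace E] [StandardBorelSpace E]
    [MeasurableSpace F] [StandardBorelSpace F] [Nonempty F] [MeasurableSpace G]
    [MeasurableSingletonClass G] (γ : Measure (F × E)) [IsFiniteMeasure γ]
    [NullSingletonClass (γ.map Prod.snd)] (t : SimpleFunc E G) :
    ∃ S : E → F, Measurable S ∧
      (γ.map Prod.snd).map (fun y => (S y, t y)) = γ.map (fun z => (z.1, t z.2)) := by
  set ν := γ.map Prod.snd with hν
  -- On each cell of t, the restricted ν has the same mass as the part of γ above that cell, so it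
  -- can be transported onto the first marginal of that part.
  have key : ∀ j : G, ∃ S : E → F, Measurable S ∧
      (ν.restrict (t ⁻¹' {j})).map S = (γ.restrict (Prod.snd ⁻¹' (t ⁻¹' {j}))).map Prod.fst := by
    intro j
    refine exists_map_eq_of_measure_univ_eq _ _ ?_
    rw [Measure.restrict_apply_univ, Measure.map_apply measurable_fst MeasurableSet.univ,
      preimage_univ, Measure.restrict_apply_univ, hν,
      Measure.map_apply measurable_snd (t.measurableSet_preimage _)]
  choose S hS hSmap using key
  have hSm : Measurable fun y => S (t y) y := t.measurable_bind (fun j y => S j y) hS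
  refine ⟨fun y => S (t y) y, hSm, ?_⟩
  have hm1 : Measurable fun y => (S (t y) y, t y) := hSm.prodMk t.measurable
  have hm2 : Measurable fun z : F × E => (z.1, t z.2) :=
    measurable_fst.prodMk (t.measurable.comp measurable_snd)
  ext D hD
  rw [Measure.map_apply hm1 hD, Measure.map_apply hm2 hD]
  set A := (fun y => (S (t y) y, t y)) ⁻¹' D with hA
  set B := (fun z : F × E => (z.1, t z.2)) ⁻¹' D with hB
  have hνA : ν A = ∑ j ∈ t.range, (ν.restrict A) (t ⁻¹' {j}) := by
    rw [t.sum_range_measure_preimage_singleton, Measure.restrict_apply_univ]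
  have hγB : γ B = ∑ j ∈ t.range, (γ.restrict B) (Prod.snd ⁻¹' (t ⁻¹' {j})) := by
    have := (t.comp (Prod.snd : F × E → E) measurable_snd).sum_measure_preimage_singleton
      (μ := γ.restrict B) t.range
    simp only [SimpleFunc.coe_comp, preimage_comp] at this
    rw [this, SimpleFunc.coe_range, preimage_range, preimage_univ, Measure.restrict_apply_univ]
  rw [hνA, hγB]
  refine Finset.sum_congr rfl fun j _ => ?_
  have hj : MeasurableSet ((fun x => (x, j)) ⁻¹' D : Set F) := measurable_prodMk_right hD
  have h := congrArg (fun m => m ((fun x => (x, j)) ⁻¹' D)) (hSmap j)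
  rw [Measure.map_apply (hS j) hj, Measure.map_apply measurable_fst hj,
    Measure.restrict_apply (hS j hj), Measure.restrict_apply (measurable_fst hj)] at h
  rw [Measure.restrict_apply (t.measurableSet_preimage _),
    Measure.restrict_apply (measurable_snd (t.measurableSet_preimage _))]
  convert h using 2
  · ext y
    simp only [hA, mem_inter_iff, mem_preimage, mem_singleton_iff]
    constructor <;> rintro ⟨h1, h2⟩ <;> simp_all
  · ext z
    simp only [hB, mem_inter_iff, mem_preimage, mem_singleton_iff]
    constructor <;> rintro ⟨h1, h2⟩ <;> simp_all

/-! ### The martingale condition in terms of the joint law -/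

section CondExp

variable {Ω : Type*} {m0 : MeasurableSpace Ω} {P : Measure Ω}

lemma condExp_apply_ae_eq (m : MeasurableSpace Ω) {Y : Ω → Plane} (hY : Integrable Y P) (i : Fin 2) :
    P[fun ω => Y ω i | m] =ᵐ[P] fun ω => (P[Y | m]) ω i :=
  ((EuclideanSpace.proj (𝕜 := ℝ) i).comp_condExp_comm hY).symm

/-- The martingale condition may be checked coordinate by coordinate. -/
lemma condExp_eq_iff_forall_apply (m : MeasurableSpace Ω) {X Y : Ω → Plane} (hY : Integrable Y P) :
    (P[Y | m] =ᵐ[P] X) ↔ ∀ i, P[fun ω => Y ω i | m] =ᵐ[P] fun ω => X ω i := by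
  constructor
  · intro h i
    filter_upwards [condExp_apply_ae_eq m hY i, h] with ω h1 h2
    rw [h1, h2]
  · intro h
    filter_upwards [ae_all_iff.2 fun i => condExp_apply_ae_eq m hY i, ae_all_iff.2 h]
      with ω h1 h2
    ext i
    rw [← h1 i, h2 i]

/-- The barycentres of the disintegration of a plan along its first coordinate. -/
def barycentre (γ : Measure (Plane × Plane)) [IsFiniteMeasure γ] (x : Plane) : Plane :=
  ∫ y, y ∂γ.condKernel x

lemma stronglyMeasurable_barycentre (γ : Measure (Plane × Plane)) [IsFiniteMeasure γ] :
    StronglyMeasurable (barycentre γ) :=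
  stronglyMeasurable_id.integral_kernel

variable [IsFiniteMeasure P]

/-- The conditional distribution is by definition the kernel of the joint law. Hence one barycentre
function serves for all pairs with a common law, even on different spaces. -/
lemma condExp_comap_eq_barycentre {X Y : Ω → Plane} (hX : Measurable X) (hY : Integrable Y P)
    {γ : Measure (Plane × Plane)} [IsFiniteMeasure γ] (hγ : P.map (fun ω => (X ω, Y ω)) = γ) :
    P[Y | MeasurableSpace.comap X inferInstance] =ᵐ[P] fun ω => barycentre γ (X ω) := by
  subst hγ
  refine (condExp_ae_eq_integral_condDistrib' hX hY).trans ?_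
  simp only [condDistrib, barycentre]
  rfl

/-- The martingale condition depends only on the joint law. -/
lemma condExp_comap_eq_self_iff {X Y : Ω → Plane} (hX : Measurable X) (hY : Integrable Y P)
    {γ : Measure (Plane × Plane)} [IsFiniteMeasure γ] (hγ : P.map (fun ω => (X ω, Y ω)) = γ) :
    (P[Y | MeasurableSpace.comap X inferInstance] =ᵐ[P] X) ↔
      ∀ᵐ x ∂γ.map Prod.fst, barycentre γ x = x := by
  have hfst : γ.map Prod.fst = P.map X := by
    rw [← hγ]; exact Measure.fst_map_prodMk₀ hY.1.aemeasurable
  have hms : MeasurableSet {x | barycentre γ x = x} :=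
    measurableSet_eq_fun (stronglyMeasurable_barycentre γ).measurable measurable_id
  rw [hfst, ae_map_iff hX.aemeasurable hms]
  have h := condExp_comap_eq_barycentre hX hY hγ
  constructor
  · intro h'
    filter_upwards [h, h'] with ω h1 h2
    rw [← h1, h2]
  · intro h'
    filter_upwards [h, h'] with ω h1 h2
    rw [h1, h2]

end CondExp

lemma integrable_snd_of_memLp {γ : Measure (Plane × Plane)} [IsProbabilityMeasure γ]
    (h : MemLp (fun z : Plane × Plane => z) 2 γ) : Integrable (fun z : Plane × Plane => z.2) γ :=
  (MemLp.snd h).integrable (by norm_num)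

/-- Plans in terms of their disintegration. -/
lemma mem_plans_iff {ν : Measure Plane} {γ : Measure (Plane × Plane)} [IsProbabilityMeasure γ] :
    γ ∈ plans ν ↔ MemLp (fun z : Plane × Plane => z) 2 γ ∧ γ.map Prod.snd = ν ∧
      ∀ᵐ x ∂γ.map Prod.fst, barycentre γ x = x := by
  simp only [plans, mem_ofPred_eq]
  constructor
  · rintro ⟨-, h2, h3, h4⟩
    refine ⟨h2, h3, ?_⟩
    rw [← condExp_eq_iff_forall_apply _ (integrable_snd_of_memLp h2)] at h4
    exact (condExp_comap_eq_self_iff measurable_fst (integrable_snd_of_memLp h2)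
      (by simp)).1 h4
  · rintro ⟨h2, h3, h4⟩
    refine ⟨inferInstance, h2, h3, ?_⟩
    rw [← condExp_eq_iff_forall_apply _ (integrable_snd_of_memLp h2)]
    exact (condExp_comap_eq_self_iff measurable_fst (integrable_snd_of_memLp h2)
      (by simp)).2 h4

/-- The joint law of a martingale pair is a plan, and conversely. -/
lemma map_prodMk_mem_plans_iff {Ω : Type*} [MeasurableSpace Ω] {P : Measure Ω}
    [IsProbabilityMeasure P] {X Y : Ω → Plane} (hX : Measurable X) (hX2 : MemLp X 2 P)
    (hY : MemLp Y 2 P) :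
    P.map (fun ω => (X ω, Y ω)) ∈ plans (P.map Y) ↔
      ∀ i : Fin 2, P[fun ω => Y ω i | MeasurableSpace.comap X inferInstance]
        =ᵐ[P] fun ω => X ω i := by
  have hYi : Integrable Y P := hY.integrable (by norm_num)
  have hm : AEMeasurable (fun ω => (X ω, Y ω)) P := hX.aemeasurable.prodMk hYi.1.aemeasurable
  have := Measure.isProbabilityMeasure_map hm
  rw [mem_plans_iff, ← condExp_eq_iff_forall_apply _ hYi, condExp_comap_eq_self_iff hX hYi rfl]
  have h1 : MemLp (fun z : Plane × Plane => z) 2 (P.map fun ω => (X ω, Y ω)) := by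
    rw [memLp_map_measure_iff measurable_id'.aestronglyMeasurable hm]
    exact MemLp.of_fst_snd ⟨hX2, hY⟩
  have h2 : (P.map fun ω => (X ω, Y ω)).map Prod.snd = P.map Y :=
    Measure.snd_map_prodMk₀ hX.aemeasurable
  simp [h1, h2]

lemma measurable_cost : Measurable fun z : Plane × Plane => cost z.1 z.2 := by
  unfold cost; fun_prop

lemma mapCost_eq_planCost {Ω : Type*} [MeasurableSpace Ω] {P : Measure Ω} {X Y : Ω → Plane}
    (hX : AEMeasurable X P) (hY : AEMeasurable Y P) :
    mapCost P Y X = planCost (P.map fun ω => (X ω, Y ω)) := by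
  rw [mapCost, planCost, integral_map (hX.prodMk hY) measurable_cost.aestronglyMeasurable]

lemma mapCost_mem_planCost_image {Ω : Type*} [MeasurableSpace Ω] {P : Measure Ω}
    [IsProbabilityMeasure P] {X Y : Ω → Plane} (hY : MemLp Y 2 P) (hX : X ∈ maps P Y) :
    mapCost P Y X ∈ planCost '' plans (P.map Y) :=
  ⟨_, (map_prodMk_mem_plans_iff hX.1 hX.2.1 hY).2 hX.2.2.2,
    (mapCost_eq_planCost hX.1.aemeasurable hY.1.aemeasurable).symm⟩

/-- A martingale map on the target space induces a map on the underlying probability space. -/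
lemma exists_maps_of_plans {Ω : Type*} [MeasurableSpace Ω] {P : Measure Ω}
    [IsProbabilityMeasure P] {Y : Ω → Plane} (hY : MemLp Y 2 P) {f : Plane → Plane}
    (hf : Measurable f) (hfp : (P.map Y).map (fun y => (f y, y)) ∈ plans (P.map Y)) :
    ∃ X ∈ maps P Y, mapCost P Y X = planCost ((P.map Y).map fun y => (f y, y)) := by
  have hYm := hY.1.aemeasurable
  -- `Y` is only almost everywhere measurable, while elements of `maps` are measurable, so a
  -- measurable representative is used.
  set Y' := hYm.mk Y
  have hYY' : Y =ᵐ[P] Y' := hYm.ae_eq_mk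
  have hX : Measurable (f ∘ Y') := hf.comp hYm.measurable_mk
  have hXY : f ∘ Y' =ᵐ[P] fun ω => f (Y ω) := by
    filter_upwards [hYY'] with ω h; simp [h]
  have hmap : P.map (fun ω => ((f ∘ Y') ω, Y ω)) = (P.map Y).map fun y => (f y, y) := by
    rw [AEMeasurable.map_map_of_aemeasurable (by fun_prop) hYm]
    refine Measure.map_congr ?_
    filter_upwards [hXY] with ω h
    simp only [Function.comp_apply] at h ⊢
    rw [h]
  have hm : AEMeasurable (fun ω => ((f ∘ Y') ω, Y ω)) P := hX.aemeasurable.prodMk hYm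
  have hX2 : MemLp (f ∘ Y') 2 P := by
    have := hfp.2.1
    rw [← hmap, memLp_map_measure_iff measurable_id'.aestronglyMeasurable hm] at this
    exact this.fst
  refine ⟨f ∘ Y', ⟨hX, hX2, ⟨f, hf, hXY⟩, ?_⟩, ?_⟩
  · rw [← map_prodMk_mem_plans_iff hX hX2 hY, hmap]
    exact hfp
  · rw [mapCost_eq_planCost hX.aemeasurable hYm, hmap]

/-! ### Second moments, tightness and lower semicontinuity -/

/-- The `L²` norm as an ordinary integral. -/
lemma integral_norm_sq_eq {Ω E : Type*} [MeasurableSpace Ω] [NormedAddCommGroup E] {P : Measure Ω}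
    {f : Ω → E} (hf : MemLp f 2 P) : ∫ ω, ‖f ω‖ ^ 2 ∂P = (eLpNorm f 2 P).toReal ^ 2 := by
  rw [hf.eLpNorm_eq_integral_rpow_norm (by norm_num) (by norm_num)]
  have h0 : 0 ≤ ∫ ω, ‖f ω‖ ^ 2 ∂P := integral_nonneg fun _ => by positivity
  simp only [ENNReal.toReal_ofNat, Real.rpow_ofNat]
  rw [ENNReal.toReal_ofReal (by positivity), ← Real.rpow_natCast, ← Real.rpow_mul h0]
  norm_num

lemma integrable_norm_sq {Ω E : Type*} [MeasurableSpace Ω] [NormedAddCommGroup E] {P : Measure Ω}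
    {f : Ω → E} (hf : MemLp f 2 P) : Integrable (fun ω => ‖f ω‖ ^ 2) P :=
  hf.integrable_norm_pow (by norm_num)

/-- Sets of measures with bounded second moments are tight. -/
lemma isTightMeasureSet_of_integral_norm_sq_le {E : Type*} [NormedAddCommGroup E] [ProperSpace E]
    [MeasurableSpace E] [BorelSpace E] {S : Set (Measure E)} (M : ℝ)
    (hS : ∀ μ ∈ S, IsFiniteMeasure μ ∧ Integrable (fun z => ‖z‖ ^ 2) μ ∧ ∫ z, ‖z‖ ^ 2 ∂μ ≤ M) :
    IsTightMeasureSet S := by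
  refine isTightMeasureSet_of_tendsto_measure_norm_gt ?_
  have hlim : Tendsto (fun r : ℝ => ENNReal.ofReal (M / r ^ 2)) atTop (𝓝 0) := by
    rw [← ENNReal.ofReal_zero]
    exact ENNReal.tendsto_ofReal (tendsto_const_nhds.div_atTop (tendsto_pow_atTop (by norm_num)))
  refine tendsto_of_tendsto_of_tendsto_of_le_of_le' tendsto_const_nhds hlim
    (Eventually.of_forall fun _ => zero_le) ?_
  filter_upwards [eventually_gt_atTop 0] with r hr
  refine iSup₂_le fun μ hμ => ?_
  obtain ⟨_, hi, hM⟩ := hS μ hμ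
  have h := mul_meas_ge_le_integral_of_nonneg (μ := μ) (f := fun z : E => ‖z‖ ^ 2)
    (Eventually.of_forall fun _ => by positivity) hi (r ^ 2)
  have hle : μ.real {z | r < ‖z‖} ≤ μ.real {z | r ^ 2 ≤ ‖z‖ ^ 2} :=
    measureReal_mono fun z (hz : r < ‖z‖) => by
      show r ^ 2 ≤ ‖z‖ ^ 2
      gcongr
  rw [← ofReal_measureReal (μ := μ)]
  refine ENNReal.ofReal_le_ofReal ?_
  rw [le_div_iff₀ (by positivity)]
  nlinarith [sq_nonneg r]

/-- Integrals of nonnegative continuous functions are lower semicontinuous for weak convergence. -/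
lemma integral_le_of_tendsto {E : Type*} [TopologicalSpace E] [MeasurableSpace E] [BorelSpace E]
    [HasOuterApproxClosed E] {γs : ℕ → ProbabilityMeasure E} {γ : ProbabilityMeasure E}
    (hγ : Tendsto γs atTop (𝓝 γ)) {g : E → ℝ} (hg : Continuous g) (hg0 : 0 ≤ g) {c : ℕ → ℝ} {a : ℝ}
    (hi : ∀ n, Integrable g (γs n : Measure E)) (hc : ∀ n, ∫ z, g z ∂(γs n : Measure E) ≤ c n)
    (ha : Tendsto c atTop (𝓝 a)) :
    Integrable g (γ : Measure E) ∧ ∫ z, g z ∂(γ : Measure E) ≤ a := by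
  have h := lintegral_le_liminf_lintegral_of_forall_isOpen_measure_le_liminf_measure
    (μ := (γ : Measure E)) (μs := fun n => (γs n : Measure E)) hg hg0
    fun G hG => ProbabilityMeasure.le_liminf_measure_open_of_tendsto hγ hG
  have h2 : liminf (fun n => ∫⁻ x, ENNReal.ofReal (g x) ∂(γs n : Measure E)) atTop
      ≤ ENNReal.ofReal a := by
    rw [← (ENNReal.tendsto_ofReal ha).liminf_eq]
    refine liminf_le_liminf (Eventually.of_forall fun n => ?_)
    rw [← ofReal_integral_eq_lintegral_ofReal (hi n) (Eventually.of_forall hg0)]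
    exact ENNReal.ofReal_le_ofReal (hc n)
  have h3 := h.trans h2
  have hint : Integrable g (γ : Measure E) := by
    refine ⟨hg.aestronglyMeasurable, ?_⟩
    rw [hasFiniteIntegral_iff_ofReal (Eventually.of_forall hg0)]
    exact h3.trans_lt ENNReal.ofReal_lt_top
  refine ⟨hint, ?_⟩
  rw [← ofReal_integral_eq_lintegral_ofReal hint (Eventually.of_forall hg0)] at h3
  have ha0 : 0 ≤ a := ge_of_tendsto' ha fun n =>
    (integral_nonneg (μ := (γs n : Measure E)) hg0).trans (hc n)
  exact (ENNReal.ofReal_le_ofReal_iff ha0).1 h3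

section Plans

variable {ν : Measure Plane} {γ : Measure (Plane × Plane)}

lemma memLp_snd_of_mem_plans (hγ : γ ∈ plans ν) : MemLp (fun z : Plane × Plane => z.2) 2 γ :=
  MemLp.snd hγ.2.1

lemma memLp_fst_of_mem_plans (hγ : γ ∈ plans ν) : MemLp (fun z : Plane × Plane => z.1) 2 γ :=
  MemLp.fst hγ.2.1

lemma memLp_apply {Ω : Type*} [MeasurableSpace Ω] {P : Measure Ω} {f : Ω → Plane}
    (hf : MemLp f 2 P) (i : Fin 2) : MemLp (fun ω => f ω i) 2 P :=
  memLp_piLp_iff.1 hf i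

lemma condExp_of_mem_plans (hγ : γ ∈ plans ν) :
    γ[fun z : Plane × Plane => z.2 |
      MeasurableSpace.comap (Prod.fst : Plane × Plane → Plane) inferInstance]
      =ᵐ[γ] fun z => z.1 := by
  have := hγ.1
  exact (condExp_eq_iff_forall_apply _ (integrable_snd_of_memLp hγ.2.1)).2 hγ.2.2.2

/-- Second moments of the first marginal of a plan are controlled by those of the second. -/
lemma integral_norm_fst_sq_le (hγ : γ ∈ plans ν) : ∫ z, ‖z.1‖ ^ 2 ∂γ ≤ ∫ y, ‖y‖ ^ 2 ∂ν := by
  have hp := hγ.1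
  rw [← hγ.2.2.1, integral_map measurable_snd.aemeasurable
    (by fun_prop), integral_norm_sq_eq (memLp_fst_of_mem_plans hγ),
    integral_norm_sq_eq (memLp_snd_of_mem_plans hγ)]
  have h := eLpNorm_condExp_le_eLpNorm (μ := γ)
    (m := MeasurableSpace.comap (Prod.fst : Plane × Plane → Plane) inferInstance)
    (fun z : Plane × Plane => z.2) (p := 2) (by norm_num)
  rw [eLpNorm_congr_ae (condExp_of_mem_plans hγ)] at h
  have := ENNReal.toReal_mono (memLp_snd_of_mem_plans hγ).2.ne h
  gcongr

lemma integral_norm_snd_sq_eq (hγ : γ ∈ plans ν) : ∫ z, ‖z.2‖ ^ 2 ∂γ = ∫ y, ‖y‖ ^ 2 ∂ν := by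
  rw [← hγ.2.2.1, integral_map measurable_snd.aemeasurable (by fun_prop)]

lemma integral_norm_sq_le (hγ : γ ∈ plans ν) : ∫ z, ‖z‖ ^ 2 ∂γ ≤ 2 * ∫ y, ‖y‖ ^ 2 ∂ν := by
  have h1 := integral_norm_fst_sq_le hγ
  have h2 := integral_norm_snd_sq_eq hγ
  have i1 := integrable_norm_sq (memLp_fst_of_mem_plans hγ)
  have i2 := integrable_norm_sq (memLp_snd_of_mem_plans hγ)
  calc ∫ z, ‖z‖ ^ 2 ∂γ ≤ ∫ z, (‖z.1‖ ^ 2 + ‖z.2‖ ^ 2) ∂γ := by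
        refine integral_mono (integrable_norm_sq hγ.2.1) (i1.add i2) fun z => ?_
        rcases max_cases ‖z.1‖ ‖z.2‖ with h | h <;>
          simp only [Prod.norm_def, h.1] <;> nlinarith [sq_nonneg ‖z.1‖, sq_nonneg ‖z.2‖]
    _ ≤ 2 * ∫ y, ‖y‖ ^ 2 ∂ν := by
        rw [integral_add i1 i2]; linarith

/-- Orthogonality of martingale increments. -/
lemma integral_mul_snd_eq (hγ : γ ∈ plans ν) {h : Plane → ℝ} (hh : Measurable h) (i : Fin 2)
    (hi : Integrable (fun z : Plane × Plane => h z.1 * z.2 i) γ) :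
    ∫ z, h z.1 * z.2 i ∂γ = ∫ z, h z.1 * z.1 i ∂γ := by
  have := hγ.1
  have hm : MeasurableSpace.comap (Prod.fst : Plane × Plane → Plane) inferInstance ≤
    (inferInstance : MeasurableSpace (Plane × Plane)) := measurable_fst.comap_le
  have hs : StronglyMeasurable[MeasurableSpace.comap (Prod.fst : Plane × Plane → Plane)
      inferInstance] (fun z : Plane × Plane => h z.1) :=
    (hh.comp (comap_measurable _)).stronglyMeasurable
  have hi2 : Integrable (fun z : Plane × Plane => z.2 i) γ :=
    (memLp_apply (memLp_snd_of_mem_plans hγ) i).integrable (by norm_num)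
  rw [← integral_condExp hm]
  refine integral_congr_ae ((condExp_mul_of_stronglyMeasurable_left hs hi hi2).trans ?_)
  filter_upwards [hγ.2.2.2 i] with z hz
  simp [hz]

end Plans

/-! ### Test functions and the shifted cost -/

/-- The martingale condition can be tested against smooth compactly supported functions. -/
lemma ae_barycentre_eq_of_forall_integral_eq_zero {γ : Measure (Plane × Plane)}
    [IsProbabilityMeasure γ] (h2 : MemLp (fun z : Plane × Plane => z) 2 γ)
    (h : ∀ φ : Plane → ℝ, Continuous φ → HasCompactSupport φ → ∀ i : Fin 2,
      ∫ z, φ z.1 * (z.2 i - z.1 i) ∂γ = 0) :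
    ∀ᵐ x ∂γ.map Prod.fst, barycentre γ x = x := by
  have hi1 : Integrable (fun z : Plane × Plane => z.1) γ := (MemLp.fst h2).integrable (by norm_num)
  have hi2 := integrable_snd_of_memLp h2
  have hb : Integrable (barycentre γ) (γ.map Prod.fst) := hi2.integral_condKernel
  have hx : Integrable (fun x : Plane => x) (γ.map Prod.fst) := by
    rwa [integrable_map_measure measurable_id'.aestronglyMeasurable measurable_fst.aemeasurable]
  have key := ae_eq_zero_of_integral_contDiff_smul_eq_zero (μ := γ.map Prod.fst)
    (hb.sub hx).locallyIntegrable ?_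
  · filter_upwards [key] with x hx
    exact sub_eq_zero.1 hx
  intro φ hφ hφc
  obtain ⟨C, hC⟩ := hφ.continuous.bounded_above_of_compact_support hφc
  have hsm : ∀ {α : Type} [MeasurableSpace α] {m : Measure α} {u v : α → Plane}
      (_ : AEMeasurable u m) (_ : Integrable v m), Integrable (fun a => φ (u a) • v a) m := by
    intro α _ m u v hu hv
    exact hv.bdd_smul C (hφ.continuous.measurable.comp_aemeasurable hu).aestronglyMeasurable
      (Eventually.of_forall fun a => hC _)
  have j1 : Integrable (fun z : Plane × Plane => φ z.1 • z.1) γ := hsm measurable_fst.aemeasurable hi1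
  have j2 : Integrable (fun z : Plane × Plane => φ z.1 • z.2) γ := hsm measurable_fst.aemeasurable hi2
  have e2 : ∫ x, φ x • barycentre γ x ∂γ.map Prod.fst = ∫ z, φ z.1 • z.2 ∂γ := by
    rw [← Measure.integral_condKernel j2]
    refine integral_congr_ae (Eventually.of_forall fun x => ?_)
    simp only [barycentre]
    rw [integral_smul]
  have e1 : ∫ x, φ x • x ∂γ.map Prod.fst = ∫ z, φ z.1 • z.1 ∂γ := by
    rw [integral_map measurable_fst.aemeasurable]
    exact (hφ.continuous.measurable.smul measurable_id').aestronglyMeasurable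
  have : ∫ z, φ z.1 • (z.2 - z.1) ∂γ = 0 := by
    ext i
    have hh := (EuclideanSpace.proj (𝕜 := ℝ) i).integral_comp_comm
      (hsm (m := γ) measurable_fst.aemeasurable (hi2.sub hi1))
    have h3 := h φ hφ.continuous hφc i
    simp only [PiLp.proj_apply, Pi.sub_apply, PiLp.smul_apply, PiLp.sub_apply, smul_eq_mul] at hh
    rw [← hh, h3]
    simp
  have e : ∫ x, φ x • (barycentre γ x - x) ∂γ.map Prod.fst = 0 := by
    simp only [smul_sub] at this ⊢
    rw [integral_sub (hsm aemeasurable_id' hb) (hsm aemeasurable_id' hx), e1, e2,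
      ← integral_sub j2 j1, this]
  exact e

/-- The cost, made nonnegative by adding terms whose integral is the same for all plans. -/
def shiftedCost (z : Plane × Plane) : ℝ :=
  cost z.1 z.2 + 3 * ‖z.2‖ ^ 2 +
    ((z.1 0 * z.1 0 - z.1 0 * z.2 0) + (z.1 1 * z.1 1 - z.1 1 * z.2 1))

lemma continuous_shiftedCost : Continuous shiftedCost := by
  unfold shiftedCost cost; fun_prop

/-- The part quadratic in x is x₀² + x₀x₁ + x₁², which is positive definite, and the cross term is
-(x₀ + x₁)(y₀ + y₁). A large enough multiple of |y|² therefore suffices; 3 is generous. -/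
lemma shiftedCost_nonneg : 0 ≤ shiftedCost := by
  intro z
  simp only [shiftedCost, cost, EuclideanSpace.real_norm_sq_eq, Fin.sum_univ_two, Pi.zero_apply]
  nlinarith [sq_nonneg (z.1 0 + z.1 1), sq_nonneg (z.1 0 - 2 * z.2 0), sq_nonneg (z.1 0 - 2 * z.2 1),
    sq_nonneg (z.1 1 - 2 * z.2 0), sq_nonneg (z.1 1 - 2 * z.2 1), sq_nonneg (z.2 0 + z.2 1),
    sq_nonneg (z.2 0), sq_nonneg (z.2 1), sq_nonneg (z.1 0 + z.1 1 - z.2 0 - z.2 1),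
    sq_nonneg (z.1 0 + z.1 1 - 2 * z.2 0 - 2 * z.2 1), sq_nonneg (z.1 0 - z.2 0),
    sq_nonneg (z.1 0 - z.1 1 - 2 * z.2 0 + 2 * z.2 1)]

section Plans

variable {ν : Measure Plane} {γ : Measure (Plane × Plane)}

lemma integrable_mul_apply {Ω : Type*} [MeasurableSpace Ω] {P : Measure Ω} {f g : Ω → Plane}
    (hf : MemLp f 2 P) (hg : MemLp g 2 P) (i j : Fin 2) :
    Integrable (fun ω => f ω i * g ω j) P :=
  (memLp_apply hf i).integrable_mul (memLp_apply hg j)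

lemma integrable_cost {Ω : Type*} [MeasurableSpace Ω] {P : Measure Ω} {f g : Ω → Plane}
    (hf : MemLp f 2 P) (hg : MemLp g 2 P) : Integrable (fun ω => cost (f ω) (g ω)) P :=
  integrable_mul_apply (hf.sub hg) (hf.sub hg) 0 1

lemma integral_mul_sub_eq_zero (hγ : γ ∈ plans ν) (i : Fin 2) :
    Integrable (fun z : Plane × Plane => z.1 i * z.1 i - z.1 i * z.2 i) γ ∧
      ∫ z, (z.1 i * z.1 i - z.1 i * z.2 i) ∂γ = 0 := by
  have h1 := memLp_fst_of_mem_plans hγ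
  have h2 := memLp_snd_of_mem_plans hγ
  refine ⟨(integrable_mul_apply h1 h1 i i).sub (integrable_mul_apply h1 h2 i i), ?_⟩
  rw [integral_sub (integrable_mul_apply h1 h1 i i) (integrable_mul_apply h1 h2 i i),
    integral_mul_snd_eq hγ (h := fun x => x i) (by fun_prop) i (integrable_mul_apply h1 h2 i i),
    sub_self]

lemma integral_shiftedCost (hγ : γ ∈ plans ν) :
    Integrable shiftedCost γ ∧ ∫ z, shiftedCost z ∂γ = planCost γ + 3 * ∫ y, ‖y‖ ^ 2 ∂ν := by
  have h1 := memLp_fst_of_mem_plans hγ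
  have h2 := memLp_snd_of_mem_plans hγ
  have i1 := integrable_cost h1 h2
  have i2 := (integrable_norm_sq h2).const_mul 3
  obtain ⟨i3, e3⟩ := integral_mul_sub_eq_zero hγ 0
  obtain ⟨i4, e4⟩ := integral_mul_sub_eq_zero hγ 1
  have i12 : Integrable (fun z : Plane × Plane => cost z.1 z.2 + 3 * ‖z.2‖ ^ 2) γ := i1.add i2
  have i34 : Integrable (fun z : Plane × Plane => (z.1 0 * z.1 0 - z.1 0 * z.2 0) +
      (z.1 1 * z.1 1 - z.1 1 * z.2 1)) γ := i3.add i4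
  refine ⟨i12.add i34, ?_⟩
  unfold shiftedCost
  rw [integral_add i12 i34, integral_add i1 i2, integral_add i3 i4, e3, e4,
    integral_const_mul, integral_norm_snd_sq_eq hγ, planCost]
  ring

lemma bddBelow_planCost (ν : Measure Plane) : BddBelow (planCost '' plans ν) := by
  refine ⟨-(3 * ∫ y, ‖y‖ ^ 2 ∂ν), ?_⟩
  rintro _ ⟨γ, hγ, rfl⟩
  have h := (integral_shiftedCost hγ).2
  have : 0 ≤ ∫ z, shiftedCost z ∂γ := integral_nonneg shiftedCost_nonneg
  linarith

/-- The diagonal coupling x = y is a martingale. -/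
lemma plans_nonempty [IsProbabilityMeasure ν] (hν : MemLp (fun y : Plane => y) 2 ν) :
    (plans ν).Nonempty := by
  have hc : MeasurableSpace.comap (fun y : Plane => y) inferInstance =
      (inferInstance : MeasurableSpace Plane) := MeasurableSpace.comap_id
  have h := (map_prodMk_mem_plans_iff (P := ν) (X := fun y => y) (Y := fun y => y)
    measurable_id' hν hν).2 fun i => by
      rw [hc, condExp_of_stronglyMeasurable le_rfl]
      · exact (by fun_prop : Measurable fun y : Plane => y i).stronglyMeasurable
      · exact (memLp_apply hν i).integrable (by norm_num)
  exact ⟨_, by simpa using h⟩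

end Plans

/-! ### Closedness of the set of plans and attainment -/

/-- Testing the martingale condition is stable under weak convergence with bounded second
moments. -/
lemma integral_mul_sub_nonpos_of_tendsto {ν : Measure Plane}
    {γs : ℕ → ProbabilityMeasure (Plane × Plane)} {γ : ProbabilityMeasure (Plane × Plane)}
    (hγ : Tendsto γs atTop (𝓝 γ)) (hγs : ∀ n, (γs n : Measure (Plane × Plane)) ∈ plans ν)
    (h2 : MemLp (fun z : Plane × Plane => z) 2 (γ : Measure (Plane × Plane)))
    {φ : Plane → ℝ} (hφ : Continuous φ) {C : ℝ} (hC : ∀ x, |φ x| ≤ C) (i : Fin 2) :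
    ∫ z, φ z.1 * (z.2 i - z.1 i) ∂(γ : Measure (Plane × Plane)) ≤ 0 := by
  set M := 2 * ∫ y, ‖y‖ ^ 2 ∂ν with hM
  have hM0 : 0 ≤ M := by positivity
  have hC0 : 0 ≤ C := (abs_nonneg _).trans (hC 0)
  have hint : ∀ {m : Measure (Plane × Plane)}, MemLp (fun z : Plane × Plane => z) 2 m →
      IsProbabilityMeasure m → Integrable (fun z => φ z.1 * (z.2 i - z.1 i)) m := by
    intro m hm _
    have : Integrable (fun z : Plane × Plane => z.2 i - z.1 i) m :=
      ((memLp_apply (MemLp.snd hm) i).sub (memLp_apply (MemLp.fst hm) i)).integrable (by norm_num)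
    exact this.bdd_mul (c := C)
      (hφ.comp continuous_fst).aestronglyMeasurable (Eventually.of_forall fun z => hC _)
  refine le_of_forall_pos_le_add fun ε hε => ?_
  rw [zero_add]
  set δ := ε / (M + 1) with hδ
  have hδ0 : 0 < δ := by positivity
  -- The test integrand grows linearly and may be unbounded below. Since 2C‖z‖ ≤ δ‖z‖² + C²/δ, the
  -- added terms make it nonnegative; the constant cancels in the limit and the error δM is at most
  -- ε.
  set g : Plane × Plane → ℝ := fun z => φ z.1 * (z.2 i - z.1 i) + (δ * ‖z‖ ^ 2 + C ^ 2 / δ) with hg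
  have hgc : Continuous g := by fun_prop
  have hg0 : 0 ≤ g := by
    intro z
    have a1 : |z.2 i| ≤ ‖z‖ := (PiLp.norm_apply_le z.2 i).trans (norm_snd_le z)
    have a2 : |z.1 i| ≤ ‖z‖ := (PiLp.norm_apply_le z.1 i).trans (norm_fst_le z)
    have a3 : |z.2 i - z.1 i| ≤ 2 * ‖z‖ := by
      have := abs_sub (z.2 i) (z.1 i); linarith
    have a4 : |φ z.1 * (z.2 i - z.1 i)| ≤ C * (2 * ‖z‖) := by
      rw [abs_mul]; exact mul_le_mul (hC _) a3 (abs_nonneg _) hC0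
    have a5 : C * (2 * ‖z‖) ≤ δ * ‖z‖ ^ 2 + C ^ 2 / δ := by
      have : 0 ≤ (δ * ‖z‖ - C) ^ 2 / δ := by positivity
      have e : (δ * ‖z‖ - C) ^ 2 / δ = δ * ‖z‖ ^ 2 + C ^ 2 / δ - C * (2 * ‖z‖) := by
        field_simp; ring
      linarith
    have := neg_abs_le (φ z.1 * (z.2 i - z.1 i))
    simp only [hg, Pi.zero_apply]
    linarith
  have hgi : ∀ {m : Measure (Plane × Plane)}, MemLp (fun z : Plane × Plane => z) 2 m →
      IsProbabilityMeasure m → Integrable g m ∧ ∫ z, g z ∂m =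
        ∫ z, φ z.1 * (z.2 i - z.1 i) ∂m + (δ * ∫ z, ‖z‖ ^ 2 ∂m + C ^ 2 / δ) := by
    intro m hm hp
    have i1 := (integrable_norm_sq hm).const_mul δ
    have i2 : Integrable (fun _ : Plane × Plane => C ^ 2 / δ) m := integrable_const _
    have i12 : Integrable (fun z : Plane × Plane => δ * ‖z‖ ^ 2 + C ^ 2 / δ) m := i1.add i2
    refine ⟨(hint hm hp).add i12, ?_⟩
    simp only [hg]
    rw [integral_add (hint hm hp) i12, integral_add i1 i2, integral_const_mul]
    simp
  have hle := (integral_le_of_tendsto hγ hgc hg0 (c := fun _ => δ * M + C ^ 2 / δ)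
    (fun n => (hgi (hγs n).2.1 inferInstance).1) (fun n => ?_) tendsto_const_nhds).2
  · rw [(hgi h2 inferInstance).2] at hle
    have : 0 ≤ ∫ z, ‖z‖ ^ 2 ∂(γ : Measure (Plane × Plane)) := by positivity
    have h3 : δ * M ≤ ε := by
      rw [hδ, div_mul_eq_mul_div, div_le_iff₀ (by positivity)]
      nlinarith
    nlinarith [mul_nonneg hδ0.le this]
  · rw [(hgi (hγs n).2.1 inferInstance).2]
    have b1 := integral_norm_sq_le (hγs n)
    have j2 : Integrable (fun z : Plane × Plane => φ z.1 * z.2 i)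
        (γs n : Measure (Plane × Plane)) :=
      ((memLp_apply (memLp_snd_of_mem_plans (hγs n)) i).integrable (by norm_num)).bdd_mul (c := C)
        (hφ.comp continuous_fst).aestronglyMeasurable (Eventually.of_forall fun z => hC _)
    have j1 : Integrable (fun z : Plane × Plane => φ z.1 * z.1 i)
        (γs n : Measure (Plane × Plane)) :=
      ((memLp_apply (memLp_fst_of_mem_plans (hγs n)) i).integrable (by norm_num)).bdd_mul (c := C)
        (hφ.comp continuous_fst).aestronglyMeasurable (Eventually.of_forall fun z => hC _)
    have b2 : ∫ z, φ z.1 * (z.2 i - z.1 i) ∂(γs n : Measure (Plane × Plane)) = 0 := by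
      simp only [mul_sub]
      rw [integral_sub j2 j1, integral_mul_snd_eq (hγs n) hφ.measurable i j2, sub_self]
    rw [b2]
    have := mul_le_mul_of_nonneg_left b1 hδ0.le
    linarith

/-- The set of plans is closed under weak limits. -/
lemma mem_plans_of_tendsto {ν : Measure Plane}
    {γs : ℕ → ProbabilityMeasure (Plane × Plane)} {γ : ProbabilityMeasure (Plane × Plane)}
    (hγ : Tendsto γs atTop (𝓝 γ)) (hγs : ∀ n, (γs n : Measure (Plane × Plane)) ∈ plans ν) :
    (γ : Measure (Plane × Plane)) ∈ plans ν := by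
  have h2 : MemLp (fun z : Plane × Plane => z) 2 (γ : Measure (Plane × Plane)) := by
    rw [memLp_two_iff_integrable_sq_norm measurable_id'.aestronglyMeasurable]
    exact (integral_le_of_tendsto hγ (g := fun z => ‖z‖ ^ 2) (by fun_prop)
      (fun z => by positivity) (fun n => integrable_norm_sq (hγs n).2.1)
      (fun n => integral_norm_sq_le (hγs n)) tendsto_const_nhds).1
  refine mem_plans_iff.2 ⟨h2, ?_, ae_barycentre_eq_of_forall_integral_eq_zero h2 ?_⟩
  · have h := ProbabilityMeasure.tendsto_map_of_tendsto_of_continuous γs γ hγ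
      (continuous_snd : Continuous (Prod.snd : Plane × Plane → Plane))
    have hcst : ∀ n, (γs n).map continuous_snd.measurable.aemeasurable =
        (γs 0).map (f := (Prod.snd : Plane × Plane → Plane))
          continuous_snd.measurable.aemeasurable := by
      intro n
      apply Subtype.ext
      exact (hγs n).2.2.1.trans (hγs 0).2.2.1.symm
    simp only [hcst] at h
    have := tendsto_nhds_unique h tendsto_const_nhds
    have := congrArg (fun m : ProbabilityMeasure Plane => (m : Measure Plane)) this
    exact this.trans (hγs 0).2.2.1
  · intro φ hφ hφc i
    obtain ⟨C, hC⟩ := hφ.bounded_above_of_compact_support hφc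
    refine le_antisymm (integral_mul_sub_nonpos_of_tendsto hγ hγs h2 hφ hC i) ?_
    -- The reverse inequality is the same bound for -φ.
    have h := integral_mul_sub_nonpos_of_tendsto hγ hγs h2 (φ := fun x => -φ x) hφ.neg
      (C := C) (fun x => by rw [abs_neg]; exact hC x) i
    simp only [neg_mul, integral_neg] at h
    linarith

/-- The minimal cost over plans is attained. -/
lemma exists_isLeast_planCost {ν : Measure Plane} [IsProbabilityMeasure ν]
    (hν : MemLp (fun y : Plane => y) 2 ν) : ∃ a, IsLeast (planCost '' plans ν) a := by
  obtain ⟨u, -, hu, hmem⟩ := exists_seq_tendsto_sInf ((plans_nonempty hν).image planCost)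
    (bddBelow_planCost ν)
  choose γ₀ hγ₀ hcost using hmem
  set γs : ℕ → ProbabilityMeasure (Plane × Plane) := fun n => ⟨γ₀ n, (hγ₀ n).1⟩ with hγs
  have hmem : ∀ n, (γs n : Measure (Plane × Plane)) ∈ plans ν := hγ₀
  have htight : IsTightMeasureSet
      ((fun μ : ProbabilityMeasure (Plane × Plane) => (μ : Measure (Plane × Plane))) ''
        range γs) := by
    refine isTightMeasureSet_of_integral_norm_sq_le (2 * ∫ y, ‖y‖ ^ 2 ∂ν) ?_
    rintro _ ⟨_, ⟨n, rfl⟩, rfl⟩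
    exact ⟨inferInstance, integrable_norm_sq (hmem n).2.1, integral_norm_sq_le (hmem n)⟩
  obtain ⟨γ, -, ψ, hψ, hlim⟩ := (isCompact_closure_of_isTightMeasureSet htight).tendsto_subseq
    (fun n => subset_closure (mem_range_self n))
  have hγ := mem_plans_of_tendsto hlim fun n => hmem (ψ n)
  refine ⟨_, ⟨γ, hγ, rfl⟩, ?_⟩
  have hle := (integral_le_of_tendsto hlim continuous_shiftedCost shiftedCost_nonneg
    (c := fun n => u (ψ n) + 3 * ∫ y, ‖y‖ ^ 2 ∂ν)
    (fun n => (integral_shiftedCost (hmem (ψ n))).1)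
    (fun n => by
      rw [← hcost (ψ n)]
      exact (integral_shiftedCost (hmem (ψ n))).2.le)
    ((hu.comp hψ.tendsto_atTop).add_const _)).2
  rw [(integral_shiftedCost hγ).2] at hle
  intro b hb
  have := csInf_le (bddBelow_planCost ν) hb
  linarith

/-! ### Approximation of plans by martingale maps -/

/-- With d = v - w, the difference of products is d₀w₁ + d₁w₀ + d₀d₁; Young's inequality with weight
η handles the first two terms. -/
lemma prod_apply_sub_le (v w : Plane) {η : ℝ} (hη : 0 < η) :
    v 0 * v 1 ≤ w 0 * w 1 + ((1 + 1 / η) * ‖v - w‖ ^ 2 + η * ‖w‖ ^ 2) := by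
  simp only [EuclideanSpace.real_norm_sq_eq, Fin.sum_univ_two, PiLp.sub_apply]
  have key : ∀ d u : ℝ, d * u ≤ 1 / η * d ^ 2 / 2 + η * u ^ 2 / 2 := by
    intro d u
    have h : 0 ≤ (d - η * u) ^ 2 / η := by positivity
    have e : (d - η * u) ^ 2 / η = 1 / η * d ^ 2 + η * u ^ 2 - 2 * (d * u) := by
      field_simp; ring
    linarith
  have h1 := key (v 0 - w 0) (w 1)
  have h2 := key (v 1 - w 1) (w 0)
  have h3 : 0 ≤ 1 / η * (v 0 - w 0) ^ 2 := by positivity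
  have h4 : 0 ≤ 1 / η * (v 1 - w 1) ^ 2 := by positivity
  have h5 : 0 ≤ η * w 0 ^ 2 := by positivity
  have h6 : 0 ≤ η * w 1 ^ 2 := by positivity
  nlinarith [sq_nonneg (v 0 - w 0 - (v 1 - w 1)), sq_nonneg (v 0 - w 0), sq_nonneg (v 1 - w 1)]

/-- Continuity of the average cost with respect to the `L²` norm of the difference. -/
lemma integral_cost_le {Ω : Type*} [MeasurableSpace Ω] {P : Measure Ω} {X Y X' Y' : Ω → Plane}
    (hX : MemLp X 2 P) (hY : MemLp Y 2 P) (hX' : MemLp X' 2 P) (hY' : MemLp Y' 2 P)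
    {η : ℝ} (hη : 0 < η) :
    ∫ ω, cost (X ω) (Y ω) ∂P ≤ ∫ ω, cost (X' ω) (Y' ω) ∂P +
      ((1 + 1 / η) * ∫ ω, ‖(X ω - Y ω) - (X' ω - Y' ω)‖ ^ 2 ∂P +
        η * ∫ ω, ‖X' ω - Y' ω‖ ^ 2 ∂P) := by
  have i1 := (integrable_norm_sq ((hX.sub hY).sub (hX'.sub hY'))).const_mul (1 + 1 / η)
  have i2 := (integrable_norm_sq (hX'.sub hY')).const_mul η
  simp only [Pi.sub_apply] at i1 i2
  have i12 : Integrable (fun ω => (1 + 1 / η) * ‖(X ω - Y ω) - (X' ω - Y' ω)‖ ^ 2 +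
    η * ‖X' ω - Y' ω‖ ^ 2) P := i1.add i2
  have i0 := integrable_cost hX' hY'
  rw [← integral_const_mul, ← integral_const_mul, ← integral_add i1 i2, ← integral_add i0 i12]
  exact integral_mono (integrable_cost hX hY) (i0.add i12) fun ω =>
    prod_apply_sub_le (X ω - Y ω) (X' ω - Y' ω) hη

lemma integral_norm_sq_le_of_eLpNorm_le {Ω E : Type*} [MeasurableSpace Ω] [NormedAddCommGroup E]
    {P : Measure Ω} {f : Ω → E} (hf : MemLp f 2 P) {r : ℝ} (hr : 0 ≤ r)
    (h : eLpNorm f 2 P ≤ ENNReal.ofReal r) : ∫ ω, ‖f ω‖ ^ 2 ∂P ≤ r ^ 2 := by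
  rw [integral_norm_sq_eq hf]
  have := ENNReal.toReal_mono ENNReal.ofReal_ne_top h
  rw [ENNReal.toReal_ofReal hr] at this
  gcongr

lemma integrable_of_memLp_two {Ω E : Type*} [MeasurableSpace Ω] [NormedAddCommGroup E]
    {P : Measure Ω} [IsFiniteMeasure P] {f : Ω → E} (hf : MemLp f 2 P) : Integrable f P :=
  hf.integrable (by norm_num)

/-- Conditioning on the random variable `S` produces a martingale pair. -/
lemma condExp_comap_self_of_condExp_eq {Ω : Type*} [MeasurableSpace Ω] {P : Measure Ω}
    [IsFiniteMeasure P] {S Y : Ω → Plane} {g : Plane → Plane} (hS : Measurable S)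
    (hg : Measurable g)
    (h : P[Y | MeasurableSpace.comap S inferInstance] =ᵐ[P] fun ω => g (S ω)) :
    P[Y | MeasurableSpace.comap (fun ω => g (S ω)) inferInstance] =ᵐ[P] fun ω => g (S ω) := by
  have hgS : Measurable fun ω => g (S ω) := hg.comp hS
  have hle : MeasurableSpace.comap (fun ω => g (S ω)) inferInstance ≤
      MeasurableSpace.comap S inferInstance := by
    rw [show (fun ω => g (S ω)) = g ∘ S from rfl, ← MeasurableSpace.comap_comp]
    exact MeasurableSpace.comap_mono hg.comap_le
  have hint : Integrable (fun ω => g (S ω)) P := integrable_condExp.congr h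
  refine (condExp_condExp_of_le hle hS.comap_le).symm.trans ((condExp_congr_ae h).trans ?_)
  rw [condExp_of_stronglyMeasurable hgS.comap_le (comap_measurable _).stronglyMeasurable hint]

/-- Every plan is approximated by martingale maps: the cost of a suitable map exceeds the cost of
the plan by an amount controlled by the mesh `δ` of a discretization of the target. -/
lemma exists_map_planCost_le {ν : Measure Plane} [NullSingletonClass ν]
    {γ : Measure (Plane × Plane)} (hγ : γ ∈ plans ν) {δ : ℝ} (hδ : 0 < δ) :
    ∃ f : Plane → Plane, Measurable f ∧ ν.map (fun y => (f y, y)) ∈ plans ν ∧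
      ∀ η > 0, planCost (ν.map fun y => (f y, y)) ≤ planCost γ +
        (10 * (1 + 1 / η) * δ ^ 2 + η * (3 * ∫ z, ‖z.1 - z.2‖ ^ 2 ∂γ + 2 * δ ^ 2)) := by
  have hγp := hγ.1
  have hx := memLp_fst_of_mem_plans hγ
  have hy := memLp_snd_of_mem_plans hγ
  have hγν : γ.map Prod.snd = ν := hγ.2.2.1
  have : IsProbabilityMeasure ν :=
    hγν ▸ Measure.isProbabilityMeasure_map measurable_snd.aemeasurable
  have hid : MemLp (fun y : Plane => y) 2 ν := by
    rw [← hγν, memLp_map_measure_iff measurable_id'.aestronglyMeasurable measurable_snd.aemeasurable]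
    exact hy
  obtain ⟨t, htδ, ht⟩ := hid.exists_simpleFunc_eLpNorm_sub_lt (by norm_num)
    (ENNReal.ofReal_pos.2 hδ).ne'
  have : NullSingletonClass (γ.map Prod.snd) := hγν ▸ inferInstance
  obtain ⟨S, hS, hlaw⟩ := exists_map_prodMk_simpleFunc_eq γ t
  rw [hγν] at hlaw
  have htm := t.measurable
  have hSt : Measurable fun y => (S y, t y) := hS.prodMk htm
  have hxt : Measurable fun z : Plane × Plane => (z.1, t z.2) :=
    measurable_fst.prodMk (htm.comp measurable_snd)
  have hlaw1 : ν.map S = γ.map Prod.fst := by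
    have := congrArg (Measure.map Prod.fst) hlaw
    rwa [Measure.map_map measurable_fst hSt, Measure.map_map measurable_fst hxt] at this
  have hS2 : MemLp S 2 ν := by
    have h : MemLp (fun x : Plane => x) 2 (ν.map S) := by
      rw [hlaw1, memLp_map_measure_iff measurable_id'.aestronglyMeasurable
        measurable_fst.aemeasurable]
      exact hx
    rwa [memLp_map_measure_iff measurable_id'.aestronglyMeasurable hS.aemeasurable] at h
  have ht2 : MemLp (fun z : Plane × Plane => t z.2) 2 γ := by
    have h : MemLp t 2 (γ.map Prod.snd) := by rwa [hγν]
    rwa [memLp_map_measure_iff htm.aestronglyMeasurable measurable_snd.aemeasurable] at h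
  have hSy : Measurable fun y => (S y, y) := hS.prodMk measurable_id'
  have : IsProbabilityMeasure (ν.map fun y => (S y, y)) :=
    Measure.isProbabilityMeasure_map hSy.aemeasurable
  have : IsProbabilityMeasure (ν.map fun y => (S y, t y)) :=
    Measure.isProbabilityMeasure_map hSt.aemeasurable
  set g := barycentre (ν.map fun y => (S y, y)) with hg
  set k := barycentre (ν.map fun y => (S y, t y)) with hk
  have hgm : Measurable g := (stronglyMeasurable_barycentre _).measurable
  have hkm : Measurable k := (stronglyMeasurable_barycentre _).measurable
  have hgS : ν[fun y => y | MeasurableSpace.comap S inferInstance] =ᵐ[ν] fun y => g (S y) :=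
    condExp_comap_eq_barycentre hS (integrable_of_memLp_two hid) rfl
  have hkS : ν[t | MeasurableSpace.comap S inferInstance] =ᵐ[ν] fun y => k (S y) :=
    condExp_comap_eq_barycentre hS (integrable_of_memLp_two ht) rfl
  have hkx : γ[fun z => t z.2 |
      MeasurableSpace.comap (Prod.fst : Plane × Plane → Plane) inferInstance] =ᵐ[γ] fun z => k z.1 :=
    condExp_comap_eq_barycentre measurable_fst (integrable_of_memLp_two ht2) hlaw.symm
  have hf2 : MemLp (fun y => g (S y)) 2 ν := (hid.condExp (by norm_num)).ae_eq hgS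
  have hty : eLpNorm (fun y => t y - y) 2 ν ≤ ENNReal.ofReal δ :=
    (eLpNorm_sub_comm (⇑t) (fun y => y) 2 ν).trans_le htδ.le
  have hyt : eLpNorm (fun z : Plane × Plane => t z.2 - z.2) 2 γ ≤ ENNReal.ofReal δ := by
    have h := eLpNorm_map_measure (μ := γ) (p := 2) (g := fun y => t y - y) (f := Prod.snd)
      (htm.sub measurable_id').aestronglyMeasurable measurable_snd.aemeasurable
    rw [hγν] at h
    change eLpNorm ((fun y => t y - y) ∘ Prod.snd) 2 γ ≤ _
    rw [← h]
    exact hty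
  -- Under γ, k(x) - x = E[t(y) - y | x], of L² norm at most δ; the bound passes to S, which has the
  -- law of x.
  have hkS' : eLpNorm (fun y => k (S y) - S y) 2 ν ≤ ENNReal.ofReal δ := by
    have h1 := eLpNorm_map_measure (μ := ν) (p := 2) (g := fun x => k x - x) (f := S)
      (hkm.sub measurable_id').aestronglyMeasurable hS.aemeasurable
    have h2 := eLpNorm_map_measure (μ := γ) (p := 2) (g := fun x => k x - x) (f := Prod.fst)
      (hkm.sub measurable_id').aestronglyMeasurable measurable_fst.aemeasurable
    rw [hlaw1, h2] at h1
    change eLpNorm ((fun x => k x - x) ∘ S) 2 ν ≤ _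
    rw [← h1]
    have h3 : (fun x => k x - x) ∘ Prod.fst =ᵐ[γ] γ[(fun z => t z.2) - fun z => z.2 |
      MeasurableSpace.comap (Prod.fst : Plane × Plane → Plane) inferInstance] := by
      refine ((condExp_sub (integrable_of_memLp_two ht2) (integrable_of_memLp_two hy) _).trans
        ?_).symm
      filter_upwards [hkx, condExp_of_mem_plans hγ] with z h4 h5
      simp only [Pi.sub_apply, Function.comp_apply]
      rw [h4, h5]
    rw [eLpNorm_congr_ae h3]
    exact (eLpNorm_condExp_le_eLpNorm _ (by norm_num)).trans hyt
  have hgk : eLpNorm (fun y => g (S y) - k (S y)) 2 ν ≤ ENNReal.ofReal δ := by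
    have h3 : (fun y => g (S y) - k (S y)) =ᵐ[ν]
        ν[(fun y => y) - ⇑t | MeasurableSpace.comap S inferInstance] := by
      refine ((condExp_sub (integrable_of_memLp_two hid) (integrable_of_memLp_two ht) _).trans
        ?_).symm
      filter_upwards [hgS, hkS] with z h4 h5
      simp only [Pi.sub_apply]
      rw [h4, h5]
    rw [eLpNorm_congr_ae h3]
    exact (eLpNorm_condExp_le_eLpNorm _ (by norm_num)).trans htδ.le
  have hk2 : MemLp (fun y => k (S y)) 2 ν := (ht.condExp (by norm_num)).ae_eq hkS
  have htot : eLpNorm (fun y => (g (S y) - y) - (S y - t y)) 2 ν ≤ ENNReal.ofReal (3 * δ) := by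
    have e : (fun y => (g (S y) - y) - (S y - t y)) =
        (fun y => g (S y) - k (S y)) + ((fun y => k (S y) - S y) + fun y => t y - y) := by
      funext y; simp only [Pi.add_apply]; abel
    rw [e]
    refine (eLpNorm_add_le (hf2.sub hk2).1 ((hk2.sub hS2).add (ht.sub hid)).1 (by norm_num)).trans ?_
    have h2 := eLpNorm_add_le (hk2.sub hS2).1 (ht.sub hid).1 (p := 2) (by norm_num)
    rw [show 3 * δ = δ + (δ + δ) by ring, ENNReal.ofReal_add hδ.le (by positivity),
      ENNReal.ofReal_add hδ.le hδ.le]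
    exact add_le_add hgk (h2.trans (add_le_add hkS' hty))
  have hfm : Measurable fun y => g (S y) := hgm.comp hS
  refine ⟨fun y => g (S y), hfm, ?_, fun η hη => ?_⟩
  · have h := (map_prodMk_mem_plans_iff hfm hf2 hid).2
      ((condExp_eq_iff_forall_apply _ (integrable_of_memLp_two hid)).1
        (condExp_comap_self_of_condExp_eq hS hgm hgS))
    simpa using h
  -- Compare (f, y) with (S, t), then (x, t) with (x, y); the middle pairs have equal law. The
  -- squared errors (3δ)² and δ² give the 10, and N + (2N + 2δ²), with N = ∫|x - y|²dγ, gives the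
  -- factor of η.
  have c1 := integral_cost_le hf2 hid hS2 ht hη
  have c2 := integral_cost_le hx ht2 hx hy hη
  have e1 : ∫ y, cost (S y) (t y) ∂ν = ∫ z, cost z.1 (t z.2) ∂γ := by
    have h1 := integral_map hSt.aemeasurable (μ := ν) measurable_cost.aestronglyMeasurable
    have h2 := integral_map hxt.aemeasurable (μ := γ) measurable_cost.aestronglyMeasurable
    rw [← h1, ← h2, hlaw]
  have e2 : ∫ y, ‖S y - t y‖ ^ 2 ∂ν = ∫ z, ‖z.1 - t z.2‖ ^ 2 ∂γ := by
    have hm : Measurable fun z : Plane × Plane => ‖z.1 - z.2‖ ^ 2 := by fun_prop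
    have h1 := integral_map hSt.aemeasurable (μ := ν) hm.aestronglyMeasurable
    have h2 := integral_map hxt.aemeasurable (μ := γ) hm.aestronglyMeasurable
    rw [← h1, ← h2, hlaw]
  have e3 : ∫ z, ‖(z.1 - t z.2) - (z.1 - z.2)‖ ^ 2 ∂γ ≤ δ ^ 2 := by
    have := integral_norm_sq_le_of_eLpNorm_le (ht2.sub hy) hδ.le hyt
    refine le_of_eq_of_le (integral_congr_ae (Eventually.of_forall fun z => ?_)) this
    simp only [Pi.sub_apply]
    rw [sub_sub_sub_cancel_left, norm_sub_rev]
  have e4 := integral_norm_sq_le_of_eLpNorm_le ((hf2.sub hid).sub (hS2.sub ht))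
    (by positivity : 0 ≤ 3 * δ) htot
  have e5 : ∫ z, ‖z.1 - t z.2‖ ^ 2 ∂γ ≤ 2 * ∫ z, ‖z.1 - z.2‖ ^ 2 ∂γ + 2 * δ ^ 2 := by
    have j1 := (integrable_norm_sq (hx.sub hy)).const_mul 2
    have j2 := (integrable_norm_sq ((hx.sub ht2).sub (hx.sub hy))).const_mul 2
    have hle := integral_mono (integrable_norm_sq (hx.sub ht2)) (j1.add j2) fun z => by
      simp only [Pi.sub_apply, Pi.add_apply]
      have h := norm_add_le (z.1 - z.2) ((z.1 - t z.2) - (z.1 - z.2))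
      rw [add_sub_cancel] at h
      nlinarith [norm_nonneg (z.1 - t z.2), sq_nonneg (‖z.1 - z.2‖ -
        ‖(z.1 - t z.2) - (z.1 - z.2)‖)]
    have hadd := integral_add j1 j2
    rw [integral_const_mul, integral_const_mul] at hadd
    simp only [Pi.sub_apply, Pi.add_apply] at hle hadd
    linarith
  have hcost : planCost (ν.map fun y => (g (S y), y)) = ∫ y, cost (g (S y)) y ∂ν :=
    integral_map (hfm.prodMk measurable_id').aemeasurable measurable_cost.aestronglyMeasurable
  rw [hcost, planCost]
  simp only [Pi.sub_apply] at e4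
  have hη' : 0 ≤ 1 + 1 / η := by positivity
  have f1 := mul_le_mul_of_nonneg_left e4 hη'
  have f2 := mul_le_mul_of_nonneg_left e3 hη'
  have f3 := mul_le_mul_of_nonneg_left (e2.le.trans e5) hη.le
  linarith

/-- The cost of any plan is approached by the costs of martingale maps. -/
lemma exists_map_planCost_le_add {ν : Measure Plane} [NullSingletonClass ν]
    {γ : Measure (Plane × Plane)} (hγ : γ ∈ plans ν) {ε : ℝ} (hε : 0 < ε) :
    ∃ f : Plane → Plane, Measurable f ∧ ν.map (fun y => (f y, y)) ∈ plans ν ∧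
      planCost (ν.map fun y => (f y, y)) ≤ planCost γ + ε := by
  set N := ∫ z, ‖z.1 - z.2‖ ^ 2 ∂γ with hN
  have hN0 : 0 ≤ N := by positivity
  -- η and r make each of the two error terms at most ε/2. The mesh min(1, r) has square at most
  -- both 1 and r.
  set η := ε / (2 * (3 * N + 2)) with hη
  have hη0 : 0 < η := by positivity
  set r := ε / (20 * (1 + 1 / η)) with hr
  have hr0 : 0 < r := by positivity
  obtain ⟨f, hf, hfp, h⟩ := exists_map_planCost_le hγ (lt_min one_pos hr0)
  refine ⟨f, hf, hfp, (h η hη0).trans ?_⟩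
  have hd0 : 0 < min 1 r := lt_min one_pos hr0
  have hd1 : min 1 r ^ 2 ≤ 1 := pow_le_one₀ hd0.le (min_le_left _ _)
  have hdr : min 1 r ^ 2 ≤ r := by nlinarith [min_le_left 1 r, min_le_right 1 r]
  have h1 : 10 * (1 + 1 / η) * min 1 r ^ 2 ≤ ε / 2 := by
    calc 10 * (1 + 1 / η) * min 1 r ^ 2 ≤ 10 * (1 + 1 / η) * r := by gcongr
      _ = ε / 2 := by rw [hr]; field_simp; ring
  have h2 : η * (3 * N + 2 * min 1 r ^ 2) ≤ ε / 2 := by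
    calc η * (3 * N + 2 * min 1 r ^ 2) ≤ η * (3 * N + 2 * 1) := by gcongr
      _ = ε / 2 := by rw [hη]; field_simp
  linarith

end BackwardMartingale

end

/-! ### The minimum over plans equals the infimum over maps -/

theorem theorem3 {Ω : Type*} [MeasurableSpace Ω] (P : Measure Ω) [IsProbabilityMeasure P]
    (Y : Ω → BackwardMartingale.Plane) (hY : MemLp Y 2 P) (hν : ∀ y, P.map Y {y} = 0) :
    ∃ a : ℝ,
      IsLeast (BackwardMartingale.planCost '' BackwardMartingale.plans (P.map Y)) a ∧
      IsGLB (BackwardMartingale.mapCost P Y '' BackwardMartingale.maps P Y) a := by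
  have hYm := hY.1.aemeasurable
  have := Measure.isProbabilityMeasure_map hYm
  have : NullSingletonClass (P.map Y) := ⟨hν⟩
  have hid : MemLp (fun y : BackwardMartingale.Plane => y) 2 (P.map Y) := by
    rw [memLp_map_measure_iff measurable_id'.aestronglyMeasurable hYm]
    exact hY
  obtain ⟨a, ha⟩ := BackwardMartingale.exists_isLeast_planCost hid
  refine ⟨a, ha, ?_, fun b hb => ?_⟩
  · rintro _ ⟨X, hX, rfl⟩
    exact ha.2 (BackwardMartingale.mapCost_mem_planCost_image hY hX)
  · obtain ⟨γ, hγ, rfl⟩ := ha.1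
    refine le_of_forall_pos_le_add fun ε hε => ?_
    obtain ⟨f, hf, hfp, hle⟩ := BackwardMartingale.exists_map_planCost_le_add hγ hε
    obtain ⟨X, hX, hXc⟩ := BackwardMartingale.exists_maps_of_plans hY hf hfp
    exact (hb ⟨X, hX, rfl⟩).trans (hXc.le.trans hle)
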